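/- Let $C$ be a closed (compact, connected) Riemann surface, $L$ a holomorphic line bundle on $C$, $N\ge 0$ and $b\ge 1$ integers. Let $\pi_i: C^N\to C$ be the projections, $\mathbf{L}=\pi_1^*L\otimes\dots\otimes\pi_N^*L$, let $\Delta=\sum_{i<j}\{z_i=z_j\}$ be the divisor of diagonals in $C^N$, and let $\mathbf{L}(-b\Delta)$ be the line bundle on $C^N$ whose sections over an open set $W$ are the holomorphic sections of $\mathbf{L}$ over $W$ that are locally divisible by the $b$-th power of a local equation of $\Delta$. Let $S_N$ act on $C^N$ by permuting the coordinates and lift this action to $\mathbf{L}$, and hence to $\mathbf{L}(-b\Delta)$, as follows: a permutation $\sigma$ acts by permuting the tensor factors $\pi_i^*L$, and the result is multiplied by the sign of $\sigma$ if $b$ is odd. Let $q:C^N\to S^NC=C^N/S_N$ be the quotient map to the $N$-th symmetric power, with its quotient complex structure (a function on an open subset of $S^NC$ is holomorphic if and only if its pull-back by $q$ is holomorphic). Then there exists a holomorphic line bundle $\mathbf{L}_b$ on $S^NC$, together with an isomorphism $q^*\mathbf{L}_b\cong\mathbf{L}(-b\Delta)$ of holomorphic line bundles on $C^N$, such that for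 every open set $U\subset S^NC$ the map that takes a section of $\mathbf{L}_b$ over $U$ to its pull-back, viewed as a section of $\mathbf{L}(-b\Delta)$ through this isomorphism, is a bijection from the space of holomorphic sections of $\mathbf{L}_b$ over $U$ onto the space of $S_N$-invariant holomorphic sections of $\mathbf{L}(-b\Delta)$ over $q^{-1}(U)$. -/

import Mathlib

open Bundle Set
open scoped Manifold Topology ContDiff TensorProduct

noncomputable section

/-! ### The power `C ^ N`, the symmetric power, and their holomorphic functions -/

/-- Two `N`-tuples of points are equivalent when they differ by a permutation of the indices. -/
def symSetoid (C : Type*) (N : ℕ) : Setoid (Fin N → C) where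
  r x y := ∃ σ : Equiv.Perm (Fin N), y = x ∘ σ
  iseqv :=
    { refl := fun _ => ⟨1, rfl⟩
      symm := by
        rintro x _ ⟨σ, rfl⟩
        exact ⟨σ⁻¹, by ext i; simp⟩
      trans := by
        rintro x _ _ ⟨σ, rfl⟩ ⟨τ, rfl⟩
        exact ⟨σ * τ, by ext i; simp⟩ }

/-- The `N`th symmetric power `S^N C = C ^ N / S_N`. -/
def SymPow (C : Type*) (N : ℕ) : Type _ := Quotient (symSetoid C N)

/-- The symmetric power carries the quotient topology. -/
instance SymPow.instTopologicalSpace (C : Type*) [TopologicalSpace C] (N : ℕ) :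
    TopologicalSpace (SymPow C N) :=
  inferInstanceAs (TopologicalSpace (Quotient (symSetoid C N)))

/-- The quotient map `q : C ^ N → S^N C`. -/
def symQuot {C : Type*} {N : ℕ} (x : Fin N → C) : SymPow C N := Quotient.mk (symSetoid C N) x

theorem symQuot_comp_perm {C : Type*} {N : ℕ} (x : Fin N → C) (σ : Equiv.Perm (Fin N)) :
    symQuot (x ∘ σ) = symQuot x :=
  (Quotient.sound (s := symSetoid C N) ⟨σ, rfl⟩).symm

/-- The action of a permutation `σ` on the `S_N`-stable set `q⁻¹ U`: it sends `x` to
`σ x = x ∘ σ⁻¹`. -/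
def permPoint {C : Type*} {N : ℕ} {U : Set (SymPow C N)} (σ : Equiv.Perm (Fin N))
    (x : ↥((symQuot : (Fin N → C) → SymPow C N) ⁻¹' U)) :
    ↥((symQuot : (Fin N → C) → SymPow C N) ⁻¹' U) :=
  ⟨x.1 ∘ σ.symm, by
    have h : symQuot x.1 ∈ U := x.2
    rwa [Set.mem_preimage, symQuot_comp_perm]⟩

section

variable {C : Type*} [TopologicalSpace C] [ChartedSpace ℂ C] {N : ℕ}

/-- `f` is holomorphic at `x ∈ C ^ N` (that is, on a neighbourhood of `x`): read in the product of
the charts of `C` at the points `x i`, it is analytic as a function of `N` complex variables. -/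
def HolAt (f : (Fin N → C) → ℂ) (x : Fin N → C) : Prop :=
  AnalyticAt ℂ (fun w : Fin N → ℂ => f fun i => (chartAt ℂ (x i)).symm (w i))
    (fun i => chartAt ℂ (x i) (x i))

/-- A function on a subset `W`, extended by zero. Only used near points of open `W`. -/
def extendZero {X : Type*} {W : Set X} (f : W → ℂ) : X → ℂ := Function.extend Subtype.val f 0

/-- A function on a subset `U` of `S^N C` is holomorphic at `p ∈ U` when its pull-back to `C ^ N` is
holomorphic at the points above `p`. This is the complex structure of the quotient `C ^ N / S_N`:
its structure sheaf is the sheaf of `S_N`-invariant holomorphic functions on `C ^ N`. -/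
def SymHolAt {U : Set (SymPow C N)} (f : U → ℂ) (p : U) : Prop :=
  ∀ x : Fin N → C, symQuot x = p.1 → HolAt (fun y => extendZero f (symQuot y)) x

end

/-! ### Holomorphic line bundles on the symmetric power -/

/-- A holomorphic line bundle on `S^N C`: a topological complex line bundle all of whose
transition functions are holomorphic. -/
structure SymLineBundle (C : Type*) [TopologicalSpace C] [ChartedSpace ℂ C] (N : ℕ) where
  Fiber : SymPow C N → Type
  [addCommGroup : ∀ p, AddCommGroup (Fiber p)]
  [module : ∀ p, Module ℂ (Fiber p)]
  [topologicalSpaceFiber : ∀ p, TopologicalSpace (Fiber p)]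
  [topologicalSpaceTotal : TopologicalSpace (TotalSpace ℂ Fiber)]
  [fiberBundle : FiberBundle ℂ Fiber]
  [vectorBundle : VectorBundle ℂ ℂ Fiber]
  holomorphic_coordChange : ∀ (e e' : Trivialization ℂ (π ℂ Fiber))
    [MemTrivializationAtlas e] [MemTrivializationAtlas e'],
    ∀ p : ↥(e.baseSet ∩ e'.baseSet),
      SymHolAt (fun p' : ↥(e.baseSet ∩ e'.baseSet) => e.coordChangeL ℂ e' p'.1 (1 : ℂ)) p

attribute [instance] SymLineBundle.addCommGroup SymLineBundle.module
  SymLineBundle.topologicalSpaceFiber SymLineBundle.topologicalSpaceTotal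
  SymLineBundle.fiberBundle SymLineBundle.vectorBundle

namespace SymLineBundle

variable {C : Type*} [TopologicalSpace C] [ChartedSpace ℂ C] {N : ℕ}

/-- The holomorphic sections of a line bundle `E` on `S^N C` over `U`: those that are holomorphic
when read in local trivializations. -/
def sections (E : SymLineBundle C N) (U : Set (SymPow C N)) : Set (∀ p : U, E.Fiber p.1) :=
  {t | ∀ p : U, SymHolAt
    (fun p' : U => (trivializationAt ℂ E.Fiber p.1).linearMapAt ℂ p'.1 (t p')) p}

/-- The holomorphic sections over `W ⊆ C ^ N` of the pull-back bundle `q^* E`, whose fibre at `x` is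
the fibre of `E` at `q x` and whose local trivializations are those of `E` composed with `q`. -/
def pullbackSections (E : SymLineBundle C N) (W : Set (Fin N → C)) :
    Set (∀ x : W, E.Fiber (symQuot x.1)) :=
  {t | ∀ x : W, HolAt (extendZero
    (fun y : W => (trivializationAt ℂ E.Fiber (symQuot x.1)).linearMapAt ℂ (symQuot y.1) (t y)))
    x.1}

end SymLineBundle

/-! ### The line bundle `𝐋 = π₁^* L ⊗ ⋯ ⊗ π_N^* L` on `C ^ N` and its twist by `-b Δ` -/

open Classical in
/-- The local equation near `x` of the divisor `Δ = ∑_{i < j} {z_i = z_j}` of `C ^ N`: the product,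
over the pairs `i < j` with `x i = x j`, of the differences of the `i`th and `j`th points in the
chart of `C` at `x i = x j`. -/
def diagEq {C : Type*} [TopologicalSpace C] [ChartedSpace ℂ C] {N : ℕ} (x y : Fin N → C) : ℂ :=
  ∏ p : Fin N × Fin N with p.1 < p.2 ∧ x p.1 = x p.2,
    (chartAt ℂ (x p.1) (y p.1) - chartAt ℂ (x p.1) (y p.2))

section

variable {C : Type*} (L : C → Type*) [∀ z, AddCommGroup (L z)] [∀ z, Module ℂ (L z)] {N : ℕ}

/-- The fibre at `x` of `𝐋 = π₁^* L ⊗ ⋯ ⊗ π_N^* L`. -/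
abbrev BoxFiber (x : Fin N → C) : Type _ := ⨂[ℂ] i, L (x i)

/-- The local trivialization of `𝐋` around `x`, on the fibre at `y`: it is the product of the local
trivializations of `L` around the points `x i`, and sends `v₁ ⊗ ⋯ ⊗ v_N` to the product of the
coordinates of the `v i ∈ L (y i)`. -/
def boxCoord [TopologicalSpace C] [∀ z, TopologicalSpace (L z)] [TopologicalSpace (TotalSpace ℂ L)]
    [FiberBundle ℂ L] [VectorBundle ℂ ℂ L] (x y : Fin N → C) : BoxFiber L y →ₗ[ℂ] ℂ :=
  PiTensorProduct.lift ((MultilinearMap.mkPiAlgebra ℂ (Fin N) ℂ).compLinearMap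
    fun i => (trivializationAt ℂ L (x i)).linearMapAt ℂ (y i))

/-- The sections over `W` of the line bundle `𝐋(-b Δ)`: the holomorphic sections of `𝐋` over `W`
which near every point are the `b`th power of the local equation of `Δ` times a
holomorphic section. (For `b = 0` these are the holomorphic sections of `𝐋`.) -/
def twistedSections [TopologicalSpace C] [ChartedSpace ℂ C] [∀ z, TopologicalSpace (L z)]
    [TopologicalSpace (TotalSpace ℂ L)] [FiberBundle ℂ L] [VectorBundle ℂ ℂ L]
    (b : ℕ) (W : Set (Fin N → C)) : Set (∀ x : W, BoxFiber L x.1) :=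
  {s | ∀ x : W, ∃ h : (Fin N → C) → ℂ, HolAt h x.1 ∧
    ∀ᶠ y in 𝓝 x.1, ∀ hy : y ∈ W, boxCoord L x.1 y (s ⟨y, hy⟩) = diagEq x.1 y ^ b * h y}

/-- The lift to `𝐋` of the action of a permutation `σ` on `C ^ N`, from the fibre at `x` to the
fibre at `σ x = x ∘ σ⁻¹`: permute the tensor factors, and multiply by the sign of `σ` if `b` is
odd. -/
def permLift (b : ℕ) (σ : Equiv.Perm (Fin N)) (x : Fin N → C) :
    BoxFiber L x →ₗ[ℂ] BoxFiber L (x ∘ σ.symm) :=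
  (((Equiv.Perm.sign σ : ℤ) : ℂ) ^ b) •
    (PiTensorProduct.reindex ℂ (fun i => L (x i)) σ).toLinearMap

/-- The `S_N`-invariant sections of `𝐋(-b Δ)` over `q⁻¹ U`. -/
def invariantSections [TopologicalSpace C] [ChartedSpace ℂ C] [∀ z, TopologicalSpace (L z)]
    [TopologicalSpace (TotalSpace ℂ L)] [FiberBundle ℂ L] [VectorBundle ℂ ℂ L]
    (b : ℕ) (U : Set (SymPow C N)) :
    Set (∀ x : ↥((symQuot : (Fin N → C) → SymPow C N) ⁻¹' U), BoxFiber L x.1) :=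
  {s | s ∈ twistedSections L b (symQuot ⁻¹' U) ∧
    ∀ (σ : Equiv.Perm (Fin N)) (x : ↥((symQuot : (Fin N → C) → SymPow C N) ⁻¹' U)),
      s (permPoint σ x) = permLift L b σ x.1 (s x)}

end

end

/-! The bundle descends because `𝐋(-b Δ)` has, near every orbit, a generating section that is
`S_N`-invariant. Given a tuple, take a neighbourhood `V` of its finitely many points carrying an
injective holomorphic `φ : V → ℂ` with nonvanishing derivative and a frame `l` of `L`
(`exists_coordinate_and_frame`). On `V ^ N` consider `∏_{i<j} (φ(y_i) - φ(y_j)) ^ b · l(y_1) ⊗ ⋯ ⊗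
l(y_N)`. The product of differences is alternating, so its `b`th power produces exactly the sign in
the lifted action. It is also a local equation of `Δ`: a factor with `x_i ≠ x_j` is nonzero at `x`
by injectivity, and a factor with `x_i = x_j` is the difference of chart coordinates times a divided
difference, whose value at `x` is a nonzero derivative (`exists_diffProd_eq`). This gives
`nonempty_invariantFrame`.

Ratios of two such frames are holomorphic and invariant, hence are transition functions on `S^N C`,
and `frameBundle` is glued from them. A section of the glued bundle is a family of coefficients in
these frames. The frames vanish on the diagonals when `b ≥ 1`, so coefficients are not determined
pointwise there; they are determined by continuity, tuples of distinct points being dense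
(`neBot_nhdsWithin_injective`, `HasRatio.eq`). -/

noncomputable section

/-! ### Divided differences of analytic functions -/

open Metric in
/-- The map `a ↦ (w ↦ (w - a)⁻¹)` into the continuous functions on a compact set is analytic at the
points outside this set. -/
theorem exists_analyticAt_inv_sub (K : Set ℂ) [CompactSpace K] (c : ℂ) (hc : c ∉ K) :
    ∃ F : ℂ → C(K, ℂ), AnalyticAt ℂ F c ∧ ∀ᶠ a in 𝓝 c, ∀ w : K, F a w = ((w : ℂ) - a)⁻¹ := by
  let G : ℂ → C(K, ℂ) := fun a =>
    (⟨fun w : K => (w : ℂ), continuous_subtype_val⟩ : C(K, ℂ)) - algebraMap ℂ C(K, ℂ) a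
  have hG : ∀ a (w : K), G a w = (w : ℂ) - a := fun a w => rfl
  have hu : ∀ a ∉ K, IsUnit (G a) := fun a ha => by
    rw [ContinuousMap.isUnit_iff_forall_ne_zero]
    intro w h
    rw [hG, sub_eq_zero] at h
    exact ha (h ▸ w.2)
  have hGa : AnalyticAt ℂ G c :=
    analyticAt_const.sub ((Algebra.linearMap ℂ C(K, ℂ)).toContinuousLinearMap.analyticAt c)
  -- Inversion in the Banach algebra `C(K, ℂ)` is analytic at units, and `G` is affine.
  refine ⟨fun a => Ring.inverse (G a), ?_, ?_⟩
  · obtain ⟨u, hu'⟩ := hu c hc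
    have := analyticAt_inverse (𝕜 := ℂ) u
    rw [hu'] at this
    exact this.comp hGa
  · have hK : IsClosed K := (isCompact_iff_compactSpace.2 inferInstance).isClosed
    filter_upwards [hK.isOpen_compl.mem_nhds hc] with a ha w
    have h1 := Ring.inverse_mul_cancel _ (hu a ha)
    have h2 := congrArg (fun g : C(K, ℂ) => g w) h1
    simp only [ContinuousMap.mul_apply, ContinuousMap.one_apply, hG] at h2
    exact eq_inv_of_mul_eq_one_left h2

open Metric in
/-- The divided difference of an analytic function is analytic in both variables. -/
theorem AnalyticAt.exists_dividedDifference {f : ℂ → ℂ} {c : ℂ} (hf : AnalyticAt ℂ f c) :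
    ∃ k : ℂ × ℂ → ℂ, AnalyticAt ℂ k (c, c) ∧ k (c, c) = deriv f c ∧
      ∀ᶠ p in 𝓝 (c, c), f p.1 - f p.2 = (p.1 - p.2) * k p := by
  obtain ⟨R, hR, hfR⟩ : ∃ R > 0, DifferentiableOn ℂ f (closedBall c R) := by
    obtain ⟨r, hr, h⟩ := Metric.eventually_nhds_iff_ball.1 hf.eventually_analyticAt
    exact ⟨r / 2, by positivity, fun z hz => (h z (closedBall_subset_ball (by linarith) hz)
      ).differentiableAt.differentiableWithinAt⟩
  let K : Set ℂ := sphere c R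
  have : CompactSpace K := isCompact_iff_compactSpace.1 (isCompact_sphere c R)
  obtain ⟨F, hF, hFe⟩ := exists_analyticAt_inv_sub K c (by simp [K, hR.ne])
  let γ : C(ℝ, K) := ⟨fun θ => ⟨circleMap c R θ, circleMap_mem_sphere c hR.le θ⟩,
    (continuous_circleMap c R).subtype_mk _⟩
  let J : C(K, ℂ) →ₗ[ℂ] ℂ :=
    { toFun := fun g => ∫ θ in (0 : ℝ)..2 * Real.pi, deriv (circleMap c R) θ * g (γ θ)
      map_add' := fun g h => by
        rw [← intervalIntegral.integral_add]
        · simp [mul_add]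
        all_goals
          refine Continuous.intervalIntegrable ?_ _ _
          simp only [deriv_circleMap]
          fun_prop
      map_smul' := fun a g => by
        simp only [ContinuousMap.smul_apply, smul_eq_mul, RingHom.id_apply]
        rw [← intervalIntegral.integral_const_mul]
        congr 1; ext θ; ring }
  let I : C(K, ℂ) →L[ℂ] ℂ := J.mkContinuous (R * |2 * Real.pi - 0|) fun g => by
    refine (intervalIntegral.norm_integral_le_of_norm_le_const
      (C := R * ‖g‖) fun θ _ => ?_).trans (le_of_eq (by ring))
    rw [norm_mul, deriv_circleMap, norm_mul, norm_circleMap_zero, abs_of_pos hR, Complex.norm_I,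
      mul_one]
    exact mul_le_mul_of_nonneg_left (g.norm_coe_le_norm _) hR.le
  have hI : ∀ g : C(K, ℂ), ∀ g' : ℂ → ℂ, (∀ w : K, g w = g' w) → I g = ∮ z in C(c, R), g' z := by
    intro g g' h
    change ∫ θ in (0 : ℝ)..2 * Real.pi, deriv (circleMap c R) θ * g (γ θ) = _
    simp only [h]
    rfl
  let fK : C(K, ℂ) := ⟨fun w => f w, continuousOn_iff_continuous_domRestrict.1
    (hfR.continuousOn.mono sphere_subset_closedBall)⟩
  have hpi : (2 * Real.pi * Complex.I : ℂ) ≠ 0 := by simp [Real.pi_ne_zero]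
  -- The Cauchy integral of `f(w) / ((w - a)(w - a'))`. Subtracting Cauchy's formulas at `a` and
  -- `a'` shows that it is the divided difference. As a continuous linear functional applied to an
  -- analytic `C(K, ℂ)`-valued map, it is jointly analytic with no differentiation under the
  -- integral.
  let k : ℂ × ℂ → ℂ := fun p => (2 * Real.pi * Complex.I)⁻¹ * I (fK * (F p.1 * F p.2))
  have hk : AnalyticAt ℂ k (c, c) := by
    refine analyticAt_const.mul
      ((I.analyticAt _).comp (analyticAt_const.mul (AnalyticAt.mul ?_ ?_)))
    · exact AnalyticAt.fun_comp (f := Prod.fst) (x := (c, c)) hF analyticAt_fst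
    · exact AnalyticAt.fun_comp (f := Prod.snd) (x := (c, c)) hF analyticAt_snd
  have hcauchy : ∀ᶠ a in 𝓝 c, I (fK * F a) = (2 * Real.pi * Complex.I) * f a := by
    filter_upwards [hFe, ball_mem_nhds c hR] with a ha haR
    rw [hI _ (fun z => (z - a)⁻¹ • f z)]
    · exact hfR.circleIntegral_sub_inv_smul haR
    · intro w
      rw [ContinuousMap.mul_apply, ha w, smul_eq_mul, mul_comm]
      rfl
  have hdiff : ∀ᶠ p in 𝓝 (c, c), f p.1 - f p.2 = (p.1 - p.2) * k p := by
    rw [nhds_prod_eq]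
    filter_upwards [(hcauchy.and (hFe.and (ball_mem_nhds c hR))).prod_mk
      (hcauchy.and (hFe.and (ball_mem_nhds c hR)))] with p ⟨⟨h1, h2, h2'⟩, h3, h4, h4'⟩
    have key : fK * F p.1 - fK * F p.2 = (p.1 - p.2) • (fK * (F p.1 * F p.2)) := by
      ext w
      have hne : ∀ a ∈ ball c R, (w : ℂ) - a ≠ 0 := fun a ha h => by
        rw [sub_eq_zero] at h
        have := w.2
        rw [h, mem_sphere] at this
        exact absurd (mem_ball.1 ha) (by simp [this])
      simp only [ContinuousMap.sub_apply, ContinuousMap.mul_apply, ContinuousMap.smul_apply, h2, h4,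
        smul_eq_mul]
      field_simp [hne _ h2', hne _ h4']
      ring
    have := congrArg I key
    rw [map_sub, map_smul, h1, h3, smul_eq_mul] at this
    simp only [k]
    rw [mul_left_comm, ← this]
    field_simp
  refine ⟨k, hk, ?_, hdiff⟩
  have hl : Filter.Tendsto (slope f c) (𝓝[≠] c) (𝓝 (deriv f c)) :=
    hasDerivAt_iff_tendsto_slope.1 hf.differentiableAt.hasDerivAt
  have hcont : Filter.Tendsto (fun a : ℂ => (a, c)) (𝓝[≠] c) (𝓝 (c, c)) :=
    ((Continuous.prodMk_left c).tendsto c).mono_left nhdsWithin_le_nhds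
  -- Along `(a, c)` with `a → c`, `a ≠ c`, the function `k` is the slope of `f`.
  refine tendsto_nhds_unique (hk.continuousAt.tendsto.comp hcont) (hl.congr' ?_)
  filter_upwards [hcont.eventually hdiff, self_mem_nhdsWithin] with a ha hne
  have : a - c ≠ 0 := sub_ne_zero.2 hne
  rw [slope_def_field, ha]
  simp only [Function.comp]
  field_simp

/-! ### Holomorphic functions on `C ^ N` -/

section

variable {C : Type*} [TopologicalSpace C] [ChartedSpace ℂ C] {N : ℕ}

theorem continuousAt_chartAt_symm_pi (x : Fin N → C) :
    ContinuousAt (fun (w : Fin N → ℂ) i => (chartAt ℂ (x i)).symm (w i))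
      (fun i => chartAt ℂ (x i) (x i)) :=
  continuousAt_pi.2 fun i => ContinuousAt.comp
    (f := fun w : Fin N → ℂ => w i) (x := fun i => chartAt ℂ (x i) (x i))
    ((chartAt ℂ (x i)).continuousAt_symm (mem_chart_target ℂ (x i))) (continuousAt_apply i _)

theorem tendsto_chartAt_symm_pi (x : Fin N → C) :
    Filter.Tendsto (fun (w : Fin N → ℂ) i => (chartAt ℂ (x i)).symm (w i))
      (𝓝 fun i => chartAt ℂ (x i) (x i)) (𝓝 x) := by
  simpa [ContinuousAt] using continuousAt_chartAt_symm_pi x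

theorem eventually_mem_pi {C : Type*} [TopologicalSpace C] {x : Fin N → C}
    {V : Fin N → Set C} (hV : ∀ i, V i ∈ 𝓝 (x i)) :
    ∀ᶠ y in 𝓝 x, ∀ i, y i ∈ V i :=
  Filter.eventually_all.2 fun i => (continuous_apply i).continuousAt.eventually (hV i)

theorem eventually_mem_chart_source (x : Fin N → C) :
    ∀ᶠ y in 𝓝 x, ∀ i, y i ∈ (chartAt ℂ (x i)).source :=
  eventually_mem_pi fun i => chart_source_mem_nhds ℂ (x i)

theorem eventually_mem_chart_target (x : Fin N → C) :
    ∀ᶠ w in 𝓝 (fun i => chartAt ℂ (x i) (x i)), ∀ i, w i ∈ (chartAt ℂ (x i)).target :=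
  Filter.eventually_all.2 fun i =>
    (continuous_apply i).continuousAt.eventually (chart_target_mem_nhds ℂ (x i))

namespace HolAt

variable {f g : (Fin N → C) → ℂ} {x : Fin N → C}

theorem congr (hf : HolAt f x) (h : f =ᶠ[𝓝 x] g) : HolAt g x :=
  AnalyticAt.congr hf ((tendsto_chartAt_symm_pi x).eventually h)

theorem mul (hf : HolAt f x) (hg : HolAt g x) : HolAt (fun y => f y * g y) x :=
  AnalyticAt.mul hf hg

theorem pow (hf : HolAt f x) (n : ℕ) : HolAt (fun y => f y ^ n) x := AnalyticAt.pow hf n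

theorem div (hf : HolAt f x) (hg : HolAt g x) (h0 : g x ≠ 0) : HolAt (fun y => f y / g y) x := by
  refine AnalyticAt.div hf hg ?_
  simpa using h0

theorem sub (hf : HolAt f x) (hg : HolAt g x) : HolAt (fun y => f y - g y) x :=
  AnalyticAt.sub hf hg

theorem prod {ι : Type*} (s : Finset ι) {F : ι → (Fin N → C) → ℂ} (h : ∀ i ∈ s, HolAt (F i) x) :
    HolAt (fun y => ∏ i ∈ s, F i y) x :=
  Finset.analyticAt_fun_prod s h

/-- Only continuity is carried to nearby points: holomorphy at `y` refers to the charts at `y`, so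
it would need changes of charts, and continuity is all that the uniqueness of ratios uses. -/
theorem eventually_continuousAt (hf : HolAt f x) : ∀ᶠ y in 𝓝 x, ContinuousAt f y := by
  have hc : Filter.Tendsto (fun (y : Fin N → C) i => chartAt ℂ (x i) (y i)) (𝓝 x)
      (𝓝 fun i => chartAt ℂ (x i) (x i)) :=
    tendsto_pi_nhds.2 fun i => ((chartAt ℂ (x i)).continuousAt (mem_chart_source ℂ (x i))).tendsto.comp
      ((continuous_apply i).tendsto x)
  filter_upwards [(eventually_mem_chart_source x).eventually_nhds,
    hc.eventually (AnalyticAt.eventually_analyticAt hf)] with y hy hy'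
  have hcy : ContinuousAt (fun (y : Fin N → C) i => chartAt ℂ (x i) (y i)) y :=
    continuousAt_pi.2 fun i => ContinuousAt.comp (f := fun z : Fin N → C => z i) (x := y)
      ((chartAt ℂ (x i)).continuousAt (hy.self_of_nhds i)) (continuousAt_apply i _)
  have := ContinuousAt.comp (f := fun (y : Fin N → C) i => chartAt ℂ (x i) (y i)) (x := y)
    hy'.continuousAt hcy
  refine this.congr ?_
  filter_upwards [hy] with z hz
  simp only [Function.comp]
  congr 1
  ext i
  exact (chartAt ℂ (x i)).left_inv (hz i)

theorem continuousAt (hf : HolAt f x) : ContinuousAt f x := hf.eventually_continuousAt.self_of_nhds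

theorem comp_apply {g : C → ℂ} {i : Fin N}
    (hg : AnalyticAt ℂ (fun w => g ((chartAt ℂ (x i)).symm w)) (chartAt ℂ (x i) (x i))) :
    HolAt (fun y => g (y i)) x :=
  AnalyticAt.fun_comp (f := fun w : Fin N → ℂ => w i) (x := fun i => chartAt ℂ (x i) (x i)) hg
    ((ContinuousLinearMap.proj (R := ℂ) (φ := fun _ : Fin N => ℂ) i).analyticAt _)

theorem comp_chart_pair {k : ℂ × ℂ → ℂ} {i j : Fin N} (hij : x i = x j)
    (hk : AnalyticAt ℂ k (chartAt ℂ (x i) (x i), chartAt ℂ (x i) (x i))) :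
    HolAt (fun y => k (chartAt ℂ (x i) (y i), chartAt ℂ (x i) (y j))) x := by
  have h : AnalyticAt ℂ (fun w : Fin N → ℂ => k (w i, w j)) (fun i => chartAt ℂ (x i) (x i)) := by
    have hk' : AnalyticAt ℂ k ((fun w : Fin N → ℂ => (w i, w j)) fun i => chartAt ℂ (x i) (x i)) := by
      simpa only [← hij] using hk
    exact AnalyticAt.fun_comp (f := fun w : Fin N → ℂ => (w i, w j)) hk'
      (((ContinuousLinearMap.proj (R := ℂ) (φ := fun _ : Fin N => ℂ) i).analyticAt _).prod
        ((ContinuousLinearMap.proj (R := ℂ) (φ := fun _ : Fin N => ℂ) j).analyticAt _))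
  refine AnalyticAt.congr h ?_
  filter_upwards [eventually_mem_chart_target x] with w hw
  have hj := hw j
  simp only [← hij] at hj
  rw [(chartAt ℂ (x i)).right_inv (hw i), ← hij, (chartAt ℂ (x i)).right_inv hj]

end HolAt

/-! ### Tuples of distinct points are dense -/

/-- Shift the `i`th coordinate by `t * i`: for small `t ≠ 0` coinciding points separate, and
distinct ones stay distinct because `C` is Hausdorff. -/
theorem neBot_nhdsWithin_injective [T2Space C] (x : Fin N → C) :
    (𝓝[{y : Fin N → C | Function.Injective y}] x).NeBot := by
  let γ : ℂ → Fin N → C := fun t i =>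
    (chartAt ℂ (x i)).symm (chartAt ℂ (x i) (x i) + t * ((i : ℕ) : ℂ))
  have hγ : Filter.Tendsto (fun (t : ℂ) (i : Fin N) => chartAt ℂ (x i) (x i) + t * ((i : ℕ) : ℂ))
      (𝓝 0) (𝓝 fun i => chartAt ℂ (x i) (x i)) := by
    refine Continuous.tendsto' (by fun_prop) _ _ ?_
    simp
  have h1 : Filter.Tendsto γ (𝓝 0) (𝓝 x) := (tendsto_chartAt_symm_pi x).comp hγ
  have hsep : ∀ᶠ y in 𝓝 x, ∀ i j, x i ≠ x j → y i ≠ y j := by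
    refine Filter.eventually_all.2 fun i => Filter.eventually_all.2 fun j => ?_
    by_cases hij : x i = x j
    · simp [hij]
    · filter_upwards [(isOpen_ne_fun (continuous_apply (A := fun _ : Fin N => C) i)
        (continuous_apply j)).mem_nhds hij]
        with y hy _
      exact hy
  have h2 : ∀ᶠ t in 𝓝[≠] (0 : ℂ), Function.Injective (γ t) := by
    filter_upwards [nhdsWithin_le_nhds (h1.eventually hsep),
      nhdsWithin_le_nhds (hγ.eventually (eventually_mem_chart_target x)), self_mem_nhdsWithin]
      with t ht1 ht2 ht i j hij
    by_cases hx : x i = x j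
    · have hj := ht2 j
      have hij' := hij
      simp only [γ, ← hx] at hij' hj
      have := (chartAt ℂ (x i)).symm.injOn (ht2 i) hj hij'
      have := mul_left_cancel₀ ht (add_left_cancel this)
      exact Fin.ext (by exact_mod_cast this)
    · exact absurd hij (ht1 i j hx)
  exact Filter.Tendsto.neBot (x := 𝓝[≠] (0 : ℂ))
    (tendsto_nhdsWithin_iff.2 ⟨h1.mono_left nhdsWithin_le_nhds, h2⟩)

end

/-! ### Ratios of sections -/

section

variable {C : Type*} [TopologicalSpace C] {N : ℕ} {F : (Fin N → C) → Type*}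
  [∀ y, AddCommGroup (F y)] [∀ y, Module ℂ (F y)]

/-- Near `x`, the section `s` is the multiple of `s'` by `r`, which is continuous at `x`. -/
def HasRatio (s s' : ∀ y, F y) (r : (Fin N → C) → ℂ) (x : Fin N → C) : Prop :=
  ContinuousAt r x ∧ ∀ᶠ y in 𝓝 x, s y = r y • s' y

open Classical in
/-- The value at `x` of a function `r`, continuous at `x`, such that `s = r s'` near `x`. -/
def ratio (s s' : ∀ y, F y) (x : Fin N → C) : ℂ :=
  if h : ∃ r, HasRatio s s' r x then h.choose x else 0

/-- Near `x`, the section `s` does not vanish off the diagonals. -/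
def NonzeroOffDiag (s : ∀ y, F y) (x : Fin N → C) : Prop :=
  ∀ᶠ y in 𝓝 x, Function.Injective y → s y ≠ 0

variable {s s' s'' : ∀ y, F y} {r r' : (Fin N → C) → ℂ} {x : Fin N → C}

theorem HasRatio.mul (h : HasRatio s s' r x) (h' : HasRatio s' s'' r' x) :
    HasRatio s s'' (fun y => r y * r' y) x :=
  ⟨h.1.mul h'.1, by filter_upwards [h.2, h'.2] with y hy hy'; rw [hy, hy', mul_smul]⟩

theorem ratio_spec (h : HasRatio s s' r x) : s x = ratio s s' x • s' x := by
  have h' : ∃ r, HasRatio s s' r x := ⟨r, h⟩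
  rw [ratio, dif_pos h']
  exact h'.choose_spec.2.self_of_nhds

/-- Both sections are moved by the same linear map, which therefore drops out of their ratio. -/
theorem HasRatio.comp_perm (h : HasRatio s s' r x) (σ : Equiv.Perm (Fin N))
    (T : ∀ y, F y →ₗ[ℂ] F (y ∘ σ.symm)) (hs : ∀ᶠ y in 𝓝 x, s (y ∘ σ.symm) = T y (s y))
    (hs' : ∀ᶠ y in 𝓝 x, s' (y ∘ σ.symm) = T y (s' y)) :
    HasRatio s s' (fun y => r (y ∘ σ)) (x ∘ σ.symm) := by
  have hx : ∀ y : Fin N → C, (y ∘ σ) ∘ σ.symm = y := fun y => by ext i; simp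
  have hx' : (x ∘ σ.symm) ∘ σ = x := by ext i; simp
  have hc : ContinuousAt (fun y : Fin N → C => y ∘ σ) (x ∘ σ.symm) :=
    (continuous_pi fun i => continuous_apply _).continuousAt
  refine ⟨ContinuousAt.comp (f := fun y : Fin N → C => y ∘ σ) (by rw [hx']; exact h.1) hc, ?_⟩
  rw [ContinuousAt, hx'] at hc
  filter_upwards [hc.eventually (h.2.and (hs.and hs'))] with y ⟨h1, h2, h3⟩
  have key : ∀ z, z = (y ∘ σ) ∘ σ.symm → s z = r (y ∘ σ) • s' z := by
    rintro _ rfl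
    rw [h2, h1, map_smul, h3]
  exact key y (hx y).symm

variable [ChartedSpace ℂ C]

theorem HolAt.hasRatio (hr : HolAt r x) (h : ∀ᶠ y in 𝓝 x, s y = r y • s' y) : HasRatio s s' r x :=
  ⟨hr.continuousAt, h⟩

variable [T2Space C]

/-- The two functions agree at tuples of distinct points, where `s'` does not vanish; by density and
continuity they agree at `x`, even if `s' x = 0`. -/
theorem HasRatio.eq (h : HasRatio s s' r x) (h' : HasRatio s s' r' x) (hs : NonzeroOffDiag s' x) :
    r x = r' x := by
  have := neBot_nhdsWithin_injective x
  refine tendsto_nhds_unique (f := r) (l := 𝓝[{y : Fin N → C | Function.Injective y}] x)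
    (h.1.tendsto.mono_left nhdsWithin_le_nhds)
    ((h'.1.tendsto.mono_left nhdsWithin_le_nhds).congr' ?_)
  filter_upwards [nhdsWithin_le_nhds h.2, nhdsWithin_le_nhds h'.2, nhdsWithin_le_nhds hs,
    self_mem_nhdsWithin] with y h1 h2 h3 h4
  have h5 : (r' y - r y) • s' y = 0 := by rw [sub_smul, ← h1, ← h2, sub_self]
  exact sub_eq_zero.1 ((smul_eq_zero.1 h5).resolve_right (h3 h4))

theorem HasRatio.ratio_eq (h : HasRatio s s' r x) (hs : NonzeroOffDiag s' x) :
    ratio s s' x = r x := by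
  have h' : ∃ r, HasRatio s s' r x := ⟨r, h⟩
  rw [ratio, dif_pos h']
  exact h'.choose_spec.eq h hs

theorem HolAt.ratio_eventuallyEq (hr : HolAt r x) (h : ∀ᶠ y in 𝓝 x, s y = r y • s' y)
    (hs : NonzeroOffDiag s' x) : ratio s s' =ᶠ[𝓝 x] r := by
  filter_upwards [hr.eventually_continuousAt, h.eventually_nhds, Filter.Eventually.eventually_nhds hs]
    with y h1 h2 h3
  exact HasRatio.ratio_eq ⟨h1, h2⟩ h3

end

/-! ### Extension by zero -/

section

variable {C : Type*} {L : C → Type*} [∀ z, AddCommGroup (L z)] [∀ z, Module ℂ (L z)] {N : ℕ}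

/-- The extension by zero of a section over a subset. -/
def extendSection {W : Set (Fin N → C)} (s : ∀ x : W, BoxFiber L x.1) (y : Fin N → C) :
    BoxFiber L y := by
  classical exact if h : y ∈ W then s ⟨y, h⟩ else 0

theorem extendSection_of_mem {W : Set (Fin N → C)} (s : ∀ x : W, BoxFiber L x.1) (y : W) :
    extendSection s y.1 = s y := by
  simp [extendSection]

theorem extendZero_of_mem {X : Type*} {W : Set X} (f : W → ℂ) (y : W) : extendZero f y.1 = f y :=
  Subtype.val_injective.extend_apply f 0 y

theorem extendZero_of_notMem {X : Type*} {W : Set X} (f : W → ℂ) {y : X} (h : y ∉ W) :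
    extendZero f y = 0 :=
  Function.extend_apply' _ _ _ (by rintro ⟨a, rfl⟩; exact h a.2)

end

/-! ### Local frames of `𝐋(-b Δ)` -/

section

variable {C : Type*} [TopologicalSpace C]
  (L : C → Type*) [∀ z, AddCommGroup (L z)] [∀ z, Module ℂ (L z)]
  [∀ z, TopologicalSpace (L z)] [TopologicalSpace (TotalSpace ℂ L)]
  [FiberBundle ℂ L] [VectorBundle ℂ ℂ L] {N : ℕ}

/-- It is a tensor product of linear isomorphisms followed by `ℂ ⊗ ⋯ ⊗ ℂ ≃ ℂ`. -/
theorem boxCoord_injective {x y : Fin N → C}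
    (h : ∀ i, y i ∈ (trivializationAt ℂ L (x i)).baseSet) :
    Function.Injective (boxCoord L x y) := by
  have : boxCoord L x y = (PiTensorProduct.constantBaseRingEquiv (Fin N) ℂ).toLinearMap ∘ₗ
      (PiTensorProduct.congr fun i =>
        (trivializationAt ℂ L (x i)).linearEquivAt ℂ (y i) (h i)).toLinearMap := by
    ext v
    simp [boxCoord, PiTensorProduct.congr_tprod, Trivialization.linearMapAt_apply, h]
  rw [this]
  exact (PiTensorProduct.constantBaseRingEquiv (Fin N) ℂ).injective.comp (LinearEquiv.injective _)

theorem eventually_boxCoord_injective (x : Fin N → C) :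
    ∀ᶠ y in 𝓝 x, Function.Injective (boxCoord L x y) := by
  filter_upwards [eventually_mem_pi fun i => (trivializationAt ℂ L (x i)).open_baseSet.mem_nhds
    (FiberBundle.mem_baseSet_trivializationAt ℂ L (x i))] with y hy
  exact boxCoord_injective L hy

variable [ChartedSpace ℂ C]

theorem diagEq_ne_zero {x y : Fin N → C} (h : ∀ i, y i ∈ (chartAt ℂ (x i)).source)
    (hy : Function.Injective y) : diagEq x y ≠ 0 := by
  classical
  refine Finset.prod_ne_zero_iff.2 fun p hp => sub_ne_zero.2 fun hp' => ?_
  have hp := (Finset.mem_filter.1 hp).2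
  exact hp.1.ne (hy ((chartAt ℂ (x p.1)).injOn (h p.1) (by rw [hp.2]; exact h p.2) hp'))

/-- The section `s` of `𝐋` generates `𝐋(-b Δ)` near `x`. -/
def IsFrameAt (b : ℕ) (s : ∀ y : Fin N → C, BoxFiber L y) (x : Fin N → C) : Prop :=
  ∃ u : (Fin N → C) → ℂ, HolAt u x ∧ u x ≠ 0 ∧
    ∀ᶠ y in 𝓝 x, boxCoord L x y (s y) = diagEq x y ^ b * u y

variable {L} {b : ℕ} {s s' : ∀ y : Fin N → C, BoxFiber L y} {x : Fin N → C}

theorem IsFrameAt.nonzeroOffDiag (h : IsFrameAt L b s x) : NonzeroOffDiag s x := by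
  obtain ⟨u, hu, hu0, h⟩ := h
  filter_upwards [h, eventually_mem_chart_source x, hu.continuousAt.eventually_ne hu0]
    with y h1 h2 h3 hy h4
  rw [h4, map_zero] at h1
  exact mul_ne_zero (pow_ne_zero b (diagEq_ne_zero h2 hy)) h3 h1.symm

/-- This justifies the word "generates". The two coefficients differ by the unit `u`; the local
equation is never divided out, so the argument also holds on the diagonals. -/
theorem IsFrameAt.exists_smul_iff (h : IsFrameAt L b s' x) :
    (∃ r, HolAt r x ∧ ∀ᶠ y in 𝓝 x, s y = r y • s' y) ↔
      ∃ f, HolAt f x ∧ ∀ᶠ y in 𝓝 x, boxCoord L x y (s y) = diagEq x y ^ b * f y := by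
  obtain ⟨u, hu, hu0, h⟩ := h
  constructor
  · rintro ⟨r, hr, hs⟩
    refine ⟨fun y => r y * u y, hr.mul hu, ?_⟩
    filter_upwards [hs, h] with y h1 h2
    rw [h1, map_smul, h2, smul_eq_mul, mul_left_comm]
  · rintro ⟨f, hf, hs⟩
    refine ⟨fun y => f y / u y, hf.div hu hu0, ?_⟩
    filter_upwards [hs, h, hu.continuousAt.eventually_ne hu0, eventually_boxCoord_injective L x]
      with y h1 h2 h3 h4
    refine h4 ?_
    rw [map_smul, h1, h2, smul_eq_mul]
    field_simp

theorem IsFrameAt.exists_smul (h : IsFrameAt L b s x) (h' : IsFrameAt L b s' x) :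
    ∃ r, HolAt r x ∧ ∀ᶠ y in 𝓝 x, s y = r y • s' y := by
  obtain ⟨u, hu, -, h⟩ := h
  exact h'.exists_smul_iff.2 ⟨u, hu, h⟩

theorem IsFrameAt.hasRatio [T2Space C] (h : IsFrameAt L b s x) (h' : IsFrameAt L b s' x) :
    HasRatio s s' (ratio s s') x := by
  obtain ⟨r, hr, hs⟩ := h.exists_smul h'
  have he := hr.ratio_eventuallyEq hs h'.nonzeroOffDiag
  exact (hr.congr he.symm).hasRatio (by filter_upwards [he, hs] with y h1 h2; rw [h1, h2])

theorem IsFrameAt.holAt_ratio [T2Space C] (h : IsFrameAt L b s x) (h' : IsFrameAt L b s' x) :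
    HolAt (ratio s s') x := by
  obtain ⟨r, hr, hs⟩ := h.exists_smul h'
  exact hr.congr (hr.ratio_eventuallyEq hs h'.nonzeroOffDiag).symm

variable (L b) in
/-- An `S_N`-invariant section of `𝐋` that generates `𝐋(-b Δ)` over the preimage of an open
neighbourhood of `p` in `S^N C`. -/
structure InvariantFrame (p : SymPow C N) where
  baseSet : Set (SymPow C N)
  isOpen_baseSet : IsOpen baseSet
  mem_baseSet : p ∈ baseSet
  toSection : ∀ y : Fin N → C, BoxFiber L y
  isFrameAt : ∀ x, symQuot x ∈ baseSet → IsFrameAt L b toSection x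
  perm : ∀ (σ : Equiv.Perm (Fin N)) (x), symQuot x ∈ baseSet →
    toSection (x ∘ σ.symm) = permLift L b σ x (toSection x)

theorem mem_twistedSections_iff {W : Set (Fin N → C)} (hW : IsOpen W)
    {s : ∀ x : W, BoxFiber L x.1} {f : W → ∀ y : Fin N → C, BoxFiber L y}
    (hf : ∀ x : W, IsFrameAt L b (f x) x.1) :
    s ∈ twistedSections L b W ↔ ∀ x : W, ∃ r, HolAt r x.1 ∧
      ∀ᶠ y in 𝓝 x.1, extendSection s y = r y • f x y := by
  refine forall_congr' fun x => ?_
  rw [(hf x).exists_smul_iff]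
  refine exists_congr fun h => and_congr_right fun _ => Filter.eventually_congr ?_
  filter_upwards [hW.mem_nhds x.2] with y hy
  rw [extendSection_of_mem s ⟨y, hy⟩]
  exact ⟨fun h => h hy, fun h _ => h⟩

end

/-! ### The quotient map to the symmetric power -/

section

variable {C : Type*} {N : ℕ}

theorem symQuot_eq_iff {x y : Fin N → C} :
    symQuot x = symQuot y ↔ ∃ σ : Equiv.Perm (Fin N), y = x ∘ σ.symm := by
  refine ⟨fun h => ?_, fun ⟨σ, h⟩ => by rw [h, symQuot_comp_perm]⟩
  obtain ⟨σ, h⟩ := Quotient.exact (s := symSetoid C N) h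
  exact ⟨σ.symm, h⟩

theorem symQuot_surjective : Function.Surjective (symQuot : (Fin N → C) → SymPow C N) :=
  Quotient.mk_surjective

/-- The saturation of an open set is the union of its translates under `S_N`. -/
theorem isOpenQuotientMap_symQuot [TopologicalSpace C] :
    IsOpenQuotientMap (symQuot : (Fin N → C) → SymPow C N) := by
  refine ⟨symQuot_surjective, continuous_quotient_mk', fun V hV => ?_⟩
  refine isOpen_coinduced.2 ?_
  have : (symQuot ⁻¹' (symQuot '' V) : Set (Fin N → C)) =
      ⋃ σ : Equiv.Perm (Fin N), (fun y => y ∘ σ.symm) ⁻¹' V := by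
    ext y
    simp only [mem_preimage, mem_image, mem_iUnion]
    constructor
    · rintro ⟨x, hx, h⟩
      obtain ⟨σ, rfl⟩ := symQuot_eq_iff.1 h.symm
      exact ⟨σ, hx⟩
    · rintro ⟨σ, h⟩
      exact ⟨_, h, symQuot_comp_perm y σ.symm⟩
  exact this ▸ isOpen_iUnion fun σ => hV.preimage (continuous_pi fun i => continuous_apply _)

theorem eventually_symQuot_mem [TopologicalSpace C] {U : Set (SymPow C N)} (hU : IsOpen U)
    {x : Fin N → C} (hx : symQuot x ∈ U) : ∀ᶠ y in 𝓝 x, symQuot y ∈ U :=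
  (hU.preimage isOpenQuotientMap_symQuot.continuous).mem_nhds hx

end

/-! ### The line bundle glued from invariant frames -/

section

variable {C : Type*} [TopologicalSpace C] [ChartedSpace ℂ C]
  {L : C → Type*} [∀ z, AddCommGroup (L z)] [∀ z, Module ℂ (L z)] {N b : ℕ}

theorem ratio_comp_perm [T2Space C] {s s' : ∀ y : Fin N → C, BoxFiber L y} {r : (Fin N → C) → ℂ}
    {x : Fin N → C} (h : HasRatio s s' r x) {U : Set (SymPow C N)} (hU : IsOpen U)
    (hx : symQuot x ∈ U) (σ : Equiv.Perm (Fin N))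
    (hs : ∀ y, symQuot y ∈ U → s (y ∘ σ.symm) = permLift L b σ y (s y))
    (hs' : ∀ y, symQuot y ∈ U → s' (y ∘ σ.symm) = permLift L b σ y (s' y))
    (h0 : NonzeroOffDiag s' x) (h0' : NonzeroOffDiag s' (x ∘ σ.symm)) :
    ratio s s' (x ∘ σ.symm) = ratio s s' x := by
  have hU' : ∀ᶠ y in 𝓝 x, symQuot y ∈ U :=
    (hU.preimage isOpenQuotientMap_symQuot.continuous).mem_nhds hx
  rw [(h.comp_perm σ (permLift L b σ) (hU'.mono hs) (hU'.mono hs')).ratio_eq h0', h.ratio_eq h0]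
  congr 1
  ext i; simp

variable [∀ z, TopologicalSpace (L z)] [TopologicalSpace (TotalSpace ℂ L)]
  [FiberBundle ℂ L] [VectorBundle ℂ ℂ L]

theorem mem_baseSet_inter (f : ∀ p : SymPow C N, InvariantFrame L b p) {y : Fin N → C}
    {p : SymPow C N} (hy : symQuot y ∈ (f p).baseSet) :
    symQuot y ∈ (f (symQuot y)).baseSet ∩ (f p).baseSet :=
  ⟨(f (symQuot y)).mem_baseSet, hy⟩

theorem isFrameAt_frame (f : ∀ p : SymPow C N, InvariantFrame L b p) (x : Fin N → C) :
    IsFrameAt L b (f (symQuot x)).toSection x :=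
  (f (symQuot x)).isFrameAt x (f (symQuot x)).mem_baseSet

variable [T2Space C]

/-- The transition function between two invariant frames. -/
def transition {p p' : SymPow C N} (f : InvariantFrame L b p) (f' : InvariantFrame L b p')
    (z : SymPow C N) : ℂ :=
  ratio f.toSection f'.toSection z.out

variable {p p' : SymPow C N} (f : InvariantFrame L b p) (f' : InvariantFrame L b p')

/-- The representative chosen by `Quotient.out` is immaterial, since the ratio of two invariant
frames is constant on orbits. -/
theorem transition_symQuot {x : Fin N → C} (hx : symQuot x ∈ f.baseSet ∩ f'.baseSet) :
    transition f f' (symQuot x) = ratio f.toSection f'.toSection x := by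
  obtain ⟨σ, hσ⟩ := symQuot_eq_iff.1 (Quotient.out_eq (symQuot x)).symm
  have hx' : symQuot (x ∘ σ.symm) ∈ f.baseSet ∩ f'.baseSet := by rwa [symQuot_comp_perm]
  change ratio _ _ (Quotient.out (symQuot x)) = _
  rw [hσ]
  exact ratio_comp_perm ((f.isFrameAt x hx.1).hasRatio (f'.isFrameAt x hx.2))
    (f.isOpen_baseSet.inter f'.isOpen_baseSet) hx σ (fun y hy => f.perm σ y hy.1)
    (fun y hy => f'.perm σ y hy.2) (f'.isFrameAt x hx.2).nonzeroOffDiag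
    (f'.isFrameAt _ hx'.2).nonzeroOffDiag

theorem holAt_transition {x : Fin N → C} (hx : symQuot x ∈ f.baseSet ∩ f'.baseSet) :
    HolAt (fun y => transition f f' (symQuot y)) x := by
  refine ((f.isFrameAt x hx.1).holAt_ratio (f'.isFrameAt x hx.2)).congr ?_
  filter_upwards [eventually_symQuot_mem (f.isOpen_baseSet.inter f'.isOpen_baseSet) hx] with y hy
  rw [transition_symQuot f f' hy]

theorem transition_self {x : Fin N → C} (hx : symQuot x ∈ f.baseSet) :
    transition f f (symQuot x) = 1 := by
  rw [transition_symQuot _ _ ⟨hx, hx⟩, HasRatio.ratio_eq (r := fun _ => 1)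
    ⟨continuousAt_const, by simp⟩ (f.isFrameAt x hx).nonzeroOffDiag]

theorem section_eq_transition_smul {x : Fin N → C} (hx : symQuot x ∈ f.baseSet ∩ f'.baseSet) :
    f.toSection x = transition f f' (symQuot x) • f'.toSection x := by
  rw [transition_symQuot f f' hx]
  exact ratio_spec ((f.isFrameAt x hx.1).hasRatio (f'.isFrameAt x hx.2))

variable (f : ∀ p : SymPow C N, InvariantFrame L b p)

/-- The line bundle on `S^N C` with the given local frames. -/
def frameCore : VectorBundleCore ℂ (SymPow C N) ℂ (SymPow C N) where
  baseSet p := (f p).baseSet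
  isOpen_baseSet p := (f p).isOpen_baseSet
  indexAt := id
  mem_baseSet_at p := (f p).mem_baseSet
  -- If `s_p = g • s_{p'}`, a vector with coordinate `v` in the frame `s_p` has coordinate `g * v`
  -- in `s_{p'}`.
  coordChange p p' z := transition (f p) (f p') z • ContinuousLinearMap.id ℂ ℂ
  coordChange_self p z hz v := by
    obtain ⟨x, rfl⟩ := symQuot_surjective z
    simp [transition_self (f p) hz]
  continuousOn_coordChange p p' := by
    have h : ContinuousOn (transition (f p) (f p')) ((f p).baseSet ∩ (f p').baseSet) := by
      refine fun z hz => ContinuousAt.continuousWithinAt ?_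
      obtain ⟨x, rfl⟩ := symQuot_surjective z
      exact isOpenQuotientMap_symQuot.continuousAt_comp_iff.1 (holAt_transition _ _ hz).continuousAt
    exact h.smul continuousOn_const
  coordChange_comp p p' p'' z hz v := by
    obtain ⟨x, rfl⟩ := symQuot_surjective z
    have h1 := (f p).isFrameAt x hz.1.1
    have h2 := (f p').isFrameAt x hz.1.2
    have h3 := (f p'').isFrameAt x hz.2
    rw [transition_symQuot _ _ hz.1, transition_symQuot _ _ ⟨hz.1.2, hz.2⟩,
      transition_symQuot _ _ ⟨hz.1.1, hz.2⟩,
      ((h1.hasRatio h2).mul (h2.hasRatio h3)).ratio_eq h3.nonzeroOffDiag]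
    simp only [smul_apply, ContinuousLinearMap.id_apply, smul_eq_mul]
    ring

/-- The holomorphic line bundle on `S^N C` with the given local frames. -/
def frameBundle : SymLineBundle C N where
  Fiber := (frameCore f).Fiber
  holomorphic_coordChange := by
    rintro e e' ⟨⟨p, rfl⟩⟩ ⟨⟨p', rfl⟩⟩ ⟨z, hz⟩ x hx
    simp only at hx
    subst hx
    refine (holAt_transition (f p) (f p') hz).congr ?_
    filter_upwards [eventually_symQuot_mem ((f p).isOpen_baseSet.inter (f p').isOpen_baseSet) hz]
      with y hy
    refine (Eq.trans (extendZero_of_mem _ ⟨symQuot y, hy⟩) ?_).symm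
    refine ((frameCore f).localTriv_coordChange_eq p p' hy 1).trans ?_
    simp [frameCore]

/-- The map to `𝐋` from the pull-back of `frameBundle f`. -/
def frameMap (x : Fin N → C) : (frameBundle f).Fiber (symQuot x) →ₗ[ℂ] BoxFiber L x :=
  LinearMap.toSpanSingleton ℂ (BoxFiber L x) ((f (symQuot x)).toSection x)

theorem frameMap_apply (x : Fin N → C) (v : ℂ) :
    frameMap f x v = v • (f (symQuot x)).toSection x := rfl

/-- As `indexAt` is `id`, an element of the fibre at `z` is a coordinate in the frame chosen at `z`
itself; trivializing around `p` converts it to the frame chosen at `p`. -/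
theorem frameBundle_linearMapAt {p z : SymPow C N} (hz : z ∈ (f p).baseSet) (v : ℂ) :
    (trivializationAt ℂ (frameBundle f).Fiber p).linearMapAt ℂ z v =
      transition (f z) (f p) z * v := by
  have h : z ∈ ((frameCore f).localTriv p).baseSet := hz
  have h' : ∀ v : (frameCore f).Fiber z, ((frameCore f).localTriv p).linearMapAt ℂ z v =
      (frameCore f).coordChange z p z v := fun v =>
    congrFun (Trivialization.coe_linearMapAt_of_mem ((frameCore f).localTriv p) h) v
  exact h' v

/-- `frameMap` at `y` uses the frame chosen at `q y`, which depends on `y` without any regularity.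
Rewriting in the fixed frame chosen at `q x` turns statements about sections into statements about
one coefficient function. -/
theorem extendSection_frameMap {W : Set (Fin N → C)} (hW : IsOpen W)
    (t : ∀ x : W, (frameBundle f).Fiber (symQuot x.1)) (x : W) :
    ∀ᶠ y in 𝓝 x.1, extendSection (fun y : W => frameMap f y.1 (t y)) y =
      extendZero (fun y : W =>
        (trivializationAt ℂ (frameBundle f).Fiber (symQuot x.1)).linearMapAt ℂ (symQuot y.1) (t y)) y
        • (f (symQuot x.1)).toSection y := by
  filter_upwards [hW.mem_nhds x.2, eventually_symQuot_mem (f (symQuot x.1)).isOpen_baseSet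
    (f (symQuot x.1)).mem_baseSet] with y hy hy'
  rw [extendSection_of_mem _ ⟨y, hy⟩, extendZero_of_mem _ ⟨y, hy⟩]
  refine Eq.trans ?_ (congrArg (· • _) (frameBundle_linearMapAt f hy' (t ⟨y, hy⟩)).symm)
  have key : ∀ v : ℂ, v • (f (symQuot y)).toSection y =
      (transition (f (symQuot y)) (f (symQuot x.1)) (symQuot y) * v) •
        (f (symQuot x.1)).toSection y := fun v => by
    rw [section_eq_transition_smul _ _ (mem_baseSet_inter f hy'), smul_smul, mul_comm]
  exact key (t ⟨y, hy⟩)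

theorem frameBundle_linearMapAt_self (x : Fin N → C) (v : (frameBundle f).Fiber (symQuot x)) :
    (trivializationAt ℂ (frameBundle f).Fiber (symQuot x)).linearMapAt ℂ (symQuot x) v = v := by
  refine (frameBundle_linearMapAt f (f (symQuot x)).mem_baseSet v).trans ?_
  rw [transition_self _ (f (symQuot x)).mem_baseSet]
  exact one_mul (M := ℂ) v

theorem hasRatio_of_mem_pullbackSections {W : Set (Fin N → C)} (hW : IsOpen W)
    {t : ∀ x : W, (frameBundle f).Fiber (symQuot x.1)} (ht : t ∈ (frameBundle f).pullbackSections W)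
    (x : W) : ∃ r, r x.1 = t x ∧ HasRatio (extendSection fun y : W => frameMap f y.1 (t y))
      (f (symQuot x.1)).toSection r x.1 :=
  ⟨_, (extendZero_of_mem _ x).trans (frameBundle_linearMapAt_self f x.1 _),
    (ht x).hasRatio (extendSection_frameMap f hW t x)⟩

theorem bijOn_pullbackSections {W : Set (Fin N → C)} (hW : IsOpen W) :
    BijOn (fun (t : ∀ x : W, (frameBundle f).Fiber (symQuot x.1)) (x : W) => frameMap f x.1 (t x))
      ((frameBundle f).pullbackSections W) (twistedSections L b W) := by
  have hiff : ∀ s : ∀ x : W, BoxFiber L x.1, _ := fun s =>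
    mem_twistedSections_iff hW (s := s) fun x : W => isFrameAt_frame f x.1
  refine ⟨fun t ht => (hiff _).2 fun x => ⟨_, ht x, extendSection_frameMap f hW t x⟩, ?_, ?_⟩
  -- `frameMap f x` can be zero on the diagonals, so injectivity is not fibrewise: `t x` is
  -- recovered as the value at `x` of a continuous ratio.
  · intro t ht t' ht' htt'
    ext x
    obtain ⟨r, hr, h⟩ := hasRatio_of_mem_pullbackSections f hW ht x
    obtain ⟨r', hr', h'⟩ := hasRatio_of_mem_pullbackSections f hW ht' x
    have hs : (extendSection fun y : W => frameMap f y.1 (t y)) =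
        extendSection fun y : W => frameMap f y.1 (t' y) := congrArg extendSection htt'
    rw [hs] at h
    exact hr.symm.trans ((h.eq h' (isFrameAt_frame f x.1).nonzeroOffDiag).trans hr')
  · intro s hs
    have hr : ∀ x : W, _ := (hiff s).1 hs
    have hratio : ∀ x : W, HasRatio (extendSection s) (f (symQuot x.1)).toSection
        (ratio (extendSection s) (f (symQuot x.1)).toSection) x.1 ∧
        HolAt (ratio (extendSection s) (f (symQuot x.1)).toSection) x.1 := fun x => by
      obtain ⟨r, hr, hs⟩ := hr x
      have he := hr.ratio_eventuallyEq hs (isFrameAt_frame f x.1).nonzeroOffDiag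
      have hh := hr.congr he.symm
      exact ⟨hh.hasRatio (by filter_upwards [he, hs] with y h1 h2; rw [h1, h2]), hh⟩
    -- The preimage of `s` is its coefficient at `x` in the frame chosen at `q x`.
    refine ⟨fun x => ratio (extendSection s) (f (symQuot x.1)).toSection x.1, fun x => ?_, ?_⟩
    · refine (hratio x).2.congr ?_
      filter_upwards [hW.mem_nhds x.2, eventually_symQuot_mem (f (symQuot x.1)).isOpen_baseSet
        (f (symQuot x.1)).mem_baseSet] with y hy hy'
      rw [extendZero_of_mem _ ⟨y, hy⟩]
      refine Eq.trans ?_ (frameBundle_linearMapAt f hy' _).symm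
      rw [transition_symQuot _ _ (mem_baseSet_inter f hy'), mul_comm]
      have h3 := (f (symQuot x.1)).isFrameAt y hy'
      exact ((hratio ⟨y, hy⟩).1.mul ((isFrameAt_frame f y).hasRatio h3)).ratio_eq h3.nonzeroOffDiag
    · ext x
      refine (frameMap_apply f x.1 _).trans ?_
      rw [← ratio_spec (hratio x).1, extendSection_of_mem]

/-- Holomorphy on `S^N C` is by definition holomorphy of the pull-back, so both sides test the same
functions on `C ^ N`. -/
theorem mem_sections_iff {U : Set (SymPow C N)} (t : ∀ p : U, (frameBundle f).Fiber p.1) :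
    t ∈ (frameBundle f).sections U ↔
      (fun x : ↥((symQuot : (Fin N → C) → SymPow C N) ⁻¹' U) => t ⟨symQuot x.1, x.2⟩) ∈
        (frameBundle f).pullbackSections (symQuot ⁻¹' U) := by
  have key : ∀ p : SymPow C N, (fun y : Fin N → C => extendZero (fun p' : U =>
      (trivializationAt ℂ (frameBundle f).Fiber p).linearMapAt ℂ p'.1 (t p')) (symQuot y)) =
      extendZero fun y : ↥((symQuot : (Fin N → C) → SymPow C N) ⁻¹' U) =>
        (trivializationAt ℂ (frameBundle f).Fiber p).linearMapAt ℂ (symQuot y.1)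
          (t ⟨symQuot y.1, y.2⟩) := by
    intro p
    ext y
    by_cases hy : symQuot y ∈ U
    · refine (extendZero_of_mem _ ⟨symQuot y, hy⟩).trans (Eq.symm ?_)
      exact extendZero_of_mem _ (⟨y, hy⟩ : ↥((symQuot : (Fin N → C) → SymPow C N) ⁻¹' U))
    · refine (extendZero_of_notMem _ hy).trans (Eq.symm ?_)
      exact extendZero_of_notMem _ hy
  constructor
  · intro h x
    have := h ⟨symQuot x.1, x.2⟩ x.1 rfl
    simpa only [key] using this
  · rintro h ⟨_, hp⟩ x rfl
    have := h ⟨x, hp⟩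
    simpa only [key] using this

theorem bijOn_sections {U : Set (SymPow C N)} (hU : IsOpen U) :
    BijOn (fun (t : ∀ p : U, (frameBundle f).Fiber p.1)
        (x : ↥((symQuot : (Fin N → C) → SymPow C N) ⁻¹' U)) =>
          frameMap f x.1 (t ⟨symQuot x.1, x.2⟩))
      ((frameBundle f).sections U) (invariantSections L b U) := by
  have hW := hU.preimage (isOpenQuotientMap_symQuot (C := C) (N := N)).continuous
  have hB := bijOn_pullbackSections f hW
  have hperm : ∀ (t : U → ℂ) (σ : Equiv.Perm (Fin N)) (x : Fin N → C) (hx : symQuot x ∈ U) (z)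
      (hz : z ∈ U), z = symQuot x → t ⟨z, hz⟩ • (f z).toSection (x ∘ σ.symm) =
        permLift L b σ x (t ⟨symQuot x, hx⟩ • (f (symQuot x)).toSection x) := by
    rintro t σ x hx _ hz rfl
    rw [map_smul, (f (symQuot x)).perm σ x (f (symQuot x)).mem_baseSet]
  refine ⟨fun t ht => ⟨hB.mapsTo ((mem_sections_iff f t).1 ht), fun σ x => ?_⟩, ?_, ?_⟩
  · exact hperm t σ x.1 x.2 _ (permPoint σ x).2 (symQuot_comp_perm _ _)
  · intro t ht t' ht' h
    have := hB.injOn ((mem_sections_iff f t).1 ht) ((mem_sections_iff f t').1 ht') h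
    ext ⟨p, hp⟩
    obtain ⟨x, rfl⟩ := symQuot_surjective p
    exact congrFun this ⟨x, hp⟩
  · rintro s ⟨hs, hinv⟩
    obtain ⟨t, ht, rfl⟩ := hB.surjOn hs
    -- The coefficient of an invariant section in an invariant frame is constant on orbits. This is
    -- again shown through ratios, because on the diagonals the values of `s` do not determine it.
    have key : ∀ (x : Fin N → C) (hx : symQuot x ∈ U) (y : Fin N → C) (hy : symQuot y ∈ U),
        symQuot y = symQuot x → (t ⟨y, hy⟩ : ℂ) = t ⟨x, hx⟩ := by
      intro x hx y hy hxy
      obtain ⟨σ, rfl⟩ := symQuot_eq_iff.1 hxy.symm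
      obtain ⟨r, hr, h⟩ := hasRatio_of_mem_pullbackSections f hW ht ⟨x, hx⟩
      obtain ⟨r', hr', h'⟩ := hasRatio_of_mem_pullbackSections f hW ht ⟨_, hy⟩
      have hsec : (f (symQuot (x ∘ σ.symm))).toSection = (f (symQuot x)).toSection :=
        congrArg (fun p => (f p).toSection) hxy
      have h' : HasRatio _ (f (symQuot x)).toSection r' (x ∘ σ.symm) := hsec ▸ h'
      have h0 := (isFrameAt_frame f x).nonzeroOffDiag
      have h0' : NonzeroOffDiag (f (symQuot x)).toSection (x ∘ σ.symm) :=
        ((f (symQuot x)).isFrameAt _ (hxy ▸ (f (symQuot x)).mem_baseSet)).nonzeroOffDiag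
      refine hr'.symm.trans (Eq.trans ?_ hr)
      rw [← h.ratio_eq h0, ← h'.ratio_eq h0']
      refine ratio_comp_perm (b := b) h (hU.inter (f (symQuot x)).isOpen_baseSet)
        ⟨hx, (f (symQuot x)).mem_baseSet⟩ σ (fun y hy => ?_)
        (fun y hy => (f (symQuot x)).perm σ y hy.2) h0 h0'
      have h1 : symQuot y ∈ U := hy.1
      have h2 := hinv σ ⟨y, h1⟩
      have h3 := extendSection_of_mem (W := symQuot ⁻¹' U) (fun y => frameMap f y.1 (t y)) ⟨y, h1⟩
      exact (extendSection_of_mem _ (permPoint σ ⟨y, h1⟩)).trans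
        (h2.trans (congrArg (permLift L b σ y) h3.symm))
    have hout : ∀ p : U, symQuot (Quotient.out p.1) = p.1 := fun p => Quotient.out_eq p.1
    have hmem : ∀ p : U, symQuot (Quotient.out p.1) ∈ U := fun p => (hout p).symm ▸ p.2
    have ht' : (fun x : ↥((symQuot : (Fin N → C) → SymPow C N) ⁻¹' U) =>
        (t ⟨Quotient.out (symQuot x.1), hmem ⟨symQuot x.1, x.2⟩⟩ : ℂ)) = t := by
      ext x
      exact key x.1 x.2 _ _ (hout ⟨symQuot x.1, x.2⟩)
    refine ⟨fun p => (t ⟨Quotient.out p.1, hmem p⟩ : ℂ), (mem_sections_iff f _).2 ?_, ?_⟩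
    · exact ht'.symm ▸ ht
    · ext x
      exact congrArg (fun v : ℂ => v • (f (symQuot x.1)).toSection x.1) (congrFun ht' x)

end

/-! ### Existence of invariant frames -/

section

variable {C : Type*} [TopologicalSpace C] [ChartedSpace ℂ C]

theorem analyticAt_chart_change [IsManifold 𝓘(ℂ) ω C] {a c z : C}
    (ha : z ∈ (chartAt ℂ a).source) (hc : z ∈ (chartAt ℂ c).source) :
    AnalyticAt ℂ (fun w => chartAt ℂ c ((chartAt ℂ a).symm w)) (chartAt ℂ a z) := by
  have h := contDiffOn_ext_coord_change (I := 𝓘(ℂ)) (n := ω) c a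
  simp only [mfld_simps] at h
  have h1 : (chartAt ℂ a).target ∩ (chartAt ℂ a).symm ⁻¹' (chartAt ℂ c).source ∈
      𝓝 (chartAt ℂ a z) :=
    ((chartAt ℂ a).isOpen_inter_preimage_symm (chartAt ℂ c).open_source).mem_nhds
      ⟨(chartAt ℂ a).map_source ha, by simpa [(chartAt ℂ a).left_inv ha] using hc⟩
  exact (h.contDiffAt h1).analyticAt

/-- The two chart changes are mutually inverse, so their derivatives multiply to `1`. -/
theorem deriv_chart_change_ne_zero [IsManifold 𝓘(ℂ) ω C] {a c z : C}
    (ha : z ∈ (chartAt ℂ a).source) (hc : z ∈ (chartAt ℂ c).source) :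
    deriv (fun w => chartAt ℂ c ((chartAt ℂ a).symm w)) (chartAt ℂ a z) ≠ 0 := by
  have h1 := (analyticAt_chart_change ha hc).differentiableAt.hasDerivAt
  have h2 := (analyticAt_chart_change hc ha).differentiableAt.hasDerivAt
  have h3 : HasDerivAt (fun w => chartAt ℂ a ((chartAt ℂ c).symm (chartAt ℂ c
      ((chartAt ℂ a).symm w)))) _ (chartAt ℂ a z) := HasDerivAt.comp_of_eq (chartAt ℂ a z)
    (h := fun w => chartAt ℂ c ((chartAt ℂ a).symm w))
    (h₂ := fun w => chartAt ℂ a ((chartAt ℂ c).symm w)) h2 h1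
    (by rw [(chartAt ℂ a).left_inv ha])
  have h4 : HasDerivAt (fun w : ℂ => w) _ (chartAt ℂ a z) := h3.congr_of_eventuallyEq (by
    filter_upwards [((chartAt ℂ a).isOpen_inter_preimage_symm (chartAt ℂ c).open_source).mem_nhds
      ⟨(chartAt ℂ a).map_source ha, by simpa [(chartAt ℂ a).left_inv ha] using hc⟩] with w hw
    rw [(chartAt ℂ c).left_inv hw.2, (chartAt ℂ a).right_inv hw.1])
  intro h0
  have := h4.unique (hasDerivAt_id' _)
  rw [h0, mul_zero] at this
  exact zero_ne_one this

variable (L : C → Type*) [∀ z, AddCommGroup (L z)] [∀ z, Module ℂ (L z)]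
  [∀ z, TopologicalSpace (L z)] [TopologicalSpace (TotalSpace ℂ L)]
  [FiberBundle ℂ L] [VectorBundle ℂ ℂ L] [ContMDiffVectorBundle ω ℂ L 𝓘(ℂ)]

theorem analyticAt_linearMapAt_symm {c z : C} (hz : z ∈ (trivializationAt ℂ L c).baseSet) :
    AnalyticAt ℂ (fun w => (trivializationAt ℂ L z).linearMapAt ℂ ((chartAt ℂ z).symm w)
      ((trivializationAt ℂ L c).symm ((chartAt ℂ z).symm w) 1)) (chartAt ℂ z z) := by
  have h := contMDiffOn_coordChangeL (n := ω) (IB := 𝓘(ℂ)) (trivializationAt ℂ L c)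
    (trivializationAt ℂ L z)
  have ho := (trivializationAt ℂ L c).open_baseSet.inter (trivializationAt ℂ L z).open_baseSet
  have hz' := FiberBundle.mem_baseSet_trivializationAt ℂ L z
  have h1 := (contMDiffAt_iff.1 (h.contMDiffAt (ho.mem_nhds ⟨hz, hz'⟩))).2
  simp only [mfld_simps, contDiffWithinAt_univ] at h1
  have h2 := ((ContinuousLinearMap.apply ℂ ℂ (1 : ℂ)).analyticAt _).comp h1.analyticAt
  refine h2.congr ?_
  have hc : Filter.Tendsto (chartAt ℂ z).symm (𝓝 (chartAt ℂ z z)) (𝓝 z) := by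
    simpa [ContinuousAt] using (chartAt ℂ z).continuousAt_symm (mem_chart_target ℂ z)
  filter_upwards [hc.eventually (ho.mem_nhds ⟨hz, hz'⟩)] with w hw
  simp only [Function.comp, ContinuousLinearMap.apply_apply, chartAt_self_eq,
    OpenPartialHomeomorph.refl_apply, id]
  rw [ContinuousLinearEquiv.coe_coe, Trivialization.coordChangeL_apply _ _ hw,
    Trivialization.coe_linearMapAt_of_mem _ hw.2]

/-- Near a finite subset of `C` there are a holomorphic embedding into `ℂ` and a frame of `L`. -/
theorem exists_coordinate_and_frame [IsManifold 𝓘(ℂ) ω C] [T2Space C] {S : Set C}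
    (hS : S.Finite) :
    ∃ (V : Set C) (φ : C → ℂ) (l : ∀ z, L z), IsOpen V ∧ S ⊆ V ∧ InjOn φ V ∧ ∀ z ∈ V,
      AnalyticAt ℂ (fun w => φ ((chartAt ℂ z).symm w)) (chartAt ℂ z z) ∧
      deriv (fun w => φ ((chartAt ℂ z).symm w)) (chartAt ℂ z z) ≠ 0 ∧
      AnalyticAt ℂ (fun w => (trivializationAt ℂ L z).linearMapAt ℂ ((chartAt ℂ z).symm w)
        (l ((chartAt ℂ z).symm w))) (chartAt ℂ z z) ∧
      (trivializationAt ℂ L z).linearMapAt ℂ z (l z) ≠ 0 := by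
  classical
  obtain ⟨U, hU, hd⟩ := hS.t2_separation
  obtain ⟨n, hn⟩ := countable_iff_exists_injOn.1 hS.countable
  let O : C → Set C := fun c => U c ∩ (trivializationAt ℂ L c).baseSet ∩
    ((chartAt ℂ c).source ∩ chartAt ℂ c ⁻¹' Metric.ball (chartAt ℂ c c) 1)
  have hO : ∀ c, IsOpen (O c) := fun c =>
    ((hU c).2.inter (trivializationAt ℂ L c).open_baseSet).inter
      ((chartAt ℂ c).isOpen_inter_preimage Metric.isOpen_ball)
  have hcO : ∀ c, c ∈ O c := fun c => ⟨⟨(hU c).1, FiberBundle.mem_baseSet_trivializationAt ℂ L c⟩,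
    mem_chart_source ℂ c, Metric.mem_ball_self one_pos⟩
  -- The point of `S` whose neighbourhood contains `z`, unique by disjointness; the default `z` is
  -- taken only outside the union of the `O c`.
  let i : C → C := fun z => if h : ∃ c ∈ S, z ∈ O c then h.choose else z
  have hi : ∀ c ∈ S, ∀ z ∈ O c, i z = c := fun c hc z hz => by
    have h : ∃ c ∈ S, z ∈ O c := ⟨c, hc, hz⟩
    have h' : i z = h.choose := dif_pos h
    rw [h']
    exact hd.elim_set h.choose_spec.1 hc z h.choose_spec.2.1.1 hz.1.1
  -- On `O c` this is the chart translated to send `c` to `3 * n c`. The image lies in the unit ball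
  -- about that point, and these balls are disjoint since their centres are at least `3` apart.
  let φ : C → ℂ := fun z => chartAt ℂ (i z) z + (3 * (n (i z) : ℂ) - chartAt ℂ (i z) (i z))
  let l : ∀ z, L z := fun z => (trivializationAt ℂ L (i z)).symm z 1
  have hφ : ∀ c ∈ S, ∀ z ∈ O c, φ z = chartAt ℂ c z + (3 * (n c : ℂ) - chartAt ℂ c c) :=
    fun c hc z hz => by simp only [φ, hi c hc z hz]
  have hl : ∀ c ∈ S, ∀ z ∈ O c, l z = (trivializationAt ℂ L c).symm z 1 :=
    fun c hc z hz => by simp only [l, hi c hc z hz]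
  refine ⟨⋃ c ∈ S, O c, φ, l, isOpen_biUnion fun c _ => hO c,
    fun c hc => mem_biUnion hc (hcO c), ?_, ?_⟩
  · intro z hz z' hz' h
    obtain ⟨c, hc, hz⟩ := mem_iUnion₂.1 hz
    obtain ⟨c', hc', hz'⟩ := mem_iUnion₂.1 hz'
    rw [hφ c hc z hz, hφ c' hc' z' hz'] at h
    have hcc : c = c' := by
      by_contra hne
      have hnn : n c ≠ n c' := fun h => hne (hn hc hc' h)
      have h1 : ‖chartAt ℂ c z - chartAt ℂ c c‖ < 1 := mem_ball_iff_norm.1 hz.2.2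
      have h2 : ‖chartAt ℂ c' z' - chartAt ℂ c' c'‖ < 1 := mem_ball_iff_norm.1 hz'.2.2
      have h3 : (3 : ℂ) * ((n c : ℂ) - n c') = (chartAt ℂ c' z' - chartAt ℂ c' c') -
          (chartAt ℂ c z - chartAt ℂ c c) := by linear_combination h
      have h4 : ‖(3 : ℂ) * ((n c : ℂ) - n c')‖ < 2 := by
        rw [h3]; exact (norm_sub_le _ _).trans_lt (by linarith)
      have h5 : (1 : ℝ) ≤ ‖(n c : ℂ) - n c'‖ := by
        obtain ⟨k, hk⟩ : ∃ k : ℤ, k = (n c : ℤ) - n c' := ⟨_, rfl⟩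
        have hk' : ((n c : ℂ) - n c') = (k : ℂ) := by rw [hk]; push_cast; rfl
        rw [hk', Complex.norm_intCast]
        exact_mod_cast Int.one_le_abs (show k ≠ 0 by omega)
      rw [norm_mul] at h4
      norm_num at h4
      linarith
    subst hcc
    exact (chartAt ℂ c).injOn hz.2.1 hz'.2.1 (add_right_cancel h)
  · intro z hz
    obtain ⟨c, hc, hz⟩ := mem_iUnion₂.1 hz
    have hev : ∀ᶠ w in 𝓝 (chartAt ℂ z z), (chartAt ℂ z).symm w ∈ O c := by
      refine ((chartAt ℂ z).continuousAt_symm (mem_chart_target ℂ z)).eventually ?_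
      rw [(chartAt ℂ z).left_inv (mem_chart_source ℂ z)]
      exact (hO c).mem_nhds hz
    have he : (fun w => chartAt ℂ c ((chartAt ℂ z).symm w) + (3 * (n c : ℂ) - chartAt ℂ c c))
        =ᶠ[𝓝 (chartAt ℂ z z)] fun w => φ ((chartAt ℂ z).symm w) := by
      filter_upwards [hev] with w hw using (hφ c hc _ hw).symm
    have ha := analyticAt_chart_change (mem_chart_source ℂ z) hz.2.1
    refine ⟨(ha.add analyticAt_const).congr he, ?_, ?_, ?_⟩
    · rw [← he.deriv_eq, deriv_add_const]
      exact deriv_chart_change_ne_zero (mem_chart_source ℂ z) hz.2.1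
    · refine (analyticAt_linearMapAt_symm L hz.1.2).congr ?_
      filter_upwards [hev] with w hw
      rw [hl c hc _ hw]
    · rw [hl c hc z hz, Trivialization.coe_linearMapAt_of_mem _
        (FiberBundle.mem_baseSet_trivializationAt ℂ L z)]
      intro h0
      have h1 := ((trivializationAt ℂ L z).linearEquivAt ℂ z
        (FiberBundle.mem_baseSet_trivializationAt ℂ L z)).map_eq_zero_iff.1 h0
      have h2 := ((trivializationAt ℂ L c).linearEquivAt ℂ z hz.1.2).symm.map_eq_zero_iff.1 h1
      exact one_ne_zero h2

end

/-! ### The alternating product of differences as an equation of the diagonals -/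

section

variable {C : Type*} {N : ℕ}

/-- The product of the differences of the values of `φ` at the points of a tuple. -/
def diffProd (φ : C → ℂ) (y : Fin N → C) : ℂ :=
  ∏ p : Fin N × Fin N with p.1 < p.2, (φ (y p.1) - φ (y p.2))

theorem diffProd_comp_perm (φ : C → ℂ) (y : Fin N → C) (σ : Equiv.Perm (Fin N)) :
    diffProd φ (y ∘ σ) = ((Equiv.Perm.sign σ : ℤ) : ℂ) * diffProd φ y := by
  have h : ∀ y : Fin N → C, diffProd φ y = ∏ j, ∏ i ∈ Finset.Iio j, (φ (y i) - φ (y j)) := by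
    intro y
    rw [diffProd, Finset.prod_filter, Fintype.prod_prod_type_right]
    refine Finset.prod_congr rfl fun j _ => ?_
    rw [← Finset.prod_filter]
    exact Finset.prod_congr (by ext; simp) fun _ _ => rfl
  rw [h, h]
  exact σ.prod_Iio_comp_eq_sign_mul_prod (f := fun i j => φ (y i) - φ (y j)) fun i j => by ring

variable [TopologicalSpace C] [ChartedSpace ℂ C]

/-- The unit is the divided difference of `φ` read in the chart; at `x` it equals the derivative of
`φ`, which is nonzero. -/
theorem exists_sub_eq_chart_sub_mul {φ : C → ℂ} {x : Fin N → C} {i j : Fin N} (hij : x i = x j)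
    (hφ : AnalyticAt ℂ (fun w => φ ((chartAt ℂ (x i)).symm w)) (chartAt ℂ (x i) (x i)))
    (hφ' : deriv (fun w => φ ((chartAt ℂ (x i)).symm w)) (chartAt ℂ (x i) (x i)) ≠ 0) :
    ∃ u, HolAt u x ∧ u x ≠ 0 ∧ ∀ᶠ y in 𝓝 x,
      φ (y i) - φ (y j) = (chartAt ℂ (x i) (y i) - chartAt ℂ (x i) (y j)) * u y := by
  obtain ⟨k, hk, hk', hk''⟩ := hφ.exists_dividedDifference
  refine ⟨_, HolAt.comp_chart_pair hij hk, ?_, ?_⟩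
  · rw [← hij, hk']
    exact hφ'
  · have h1 : Filter.Tendsto (fun y : Fin N → C => chartAt ℂ (x i) (y i)) (𝓝 x)
        (𝓝 (chartAt ℂ (x i) (x i))) :=
      ((chartAt ℂ (x i)).continuousAt (mem_chart_source ℂ (x i))).tendsto.comp
        ((continuous_apply i).tendsto x)
    have h2 : Filter.Tendsto (fun y : Fin N → C => y j) (𝓝 x) (𝓝 (x i)) :=
      hij ▸ (continuous_apply j).tendsto x
    have h3 := ((chartAt ℂ (x i)).continuousAt (mem_chart_source ℂ (x i))).tendsto.comp h2
    filter_upwards [(h1.prodMk_nhds h3).eventually hk'', eventually_mem_chart_source x,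
      h2.eventually (chart_source_mem_nhds ℂ (x i))] with y hy hy1 hy2
    simpa only [Function.comp, (chartAt ℂ (x i)).left_inv (hy1 i),
      (chartAt ℂ (x i)).left_inv hy2] using hy

open Classical in
theorem diagEq_eq_prod (x y : Fin N → C) : diagEq x y = ∏ p : Fin N × Fin N with p.1 < p.2,
    if x p.1 = x p.2 then chartAt ℂ (x p.1) (y p.1) - chartAt ℂ (x p.1) (y p.2) else 1 := by
  rw [diagEq, ← Finset.prod_filter, Finset.filter_filter]

open Classical in
theorem exists_sub_eq_ite_mul {φ : C → ℂ} {V : Set C} (hinj : InjOn φ V)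
    (hφ : ∀ z ∈ V, AnalyticAt ℂ (fun w => φ ((chartAt ℂ z).symm w)) (chartAt ℂ z z) ∧
      deriv (fun w => φ ((chartAt ℂ z).symm w)) (chartAt ℂ z z) ≠ 0)
    {x : Fin N → C} (hx : ∀ i, x i ∈ V) (i j : Fin N) :
    ∃ u, HolAt u x ∧ u x ≠ 0 ∧ ∀ᶠ y in 𝓝 x, φ (y i) - φ (y j) =
      (if x i = x j then chartAt ℂ (x i) (y i) - chartAt ℂ (x i) (y j) else 1) * u y := by
  by_cases hij : x i = x j
  · simpa only [if_pos hij] using exists_sub_eq_chart_sub_mul hij (hφ _ (hx i)).1 (hφ _ (hx i)).2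
  · refine ⟨fun y => φ (y i) - φ (y j),
      (HolAt.comp_apply (hφ _ (hx i)).1).sub (HolAt.comp_apply (hφ _ (hx j)).1),
      sub_ne_zero.2 fun h => hij (hinj (hx i) (hx j) h), ?_⟩
    simp only [if_neg hij, one_mul, Filter.eventually_true]

/-- The product of the differences of a local coordinate is a local equation of `Δ`. -/
theorem exists_diffProd_eq {φ : C → ℂ} {V : Set C} (hinj : InjOn φ V)
    (hφ : ∀ z ∈ V, AnalyticAt ℂ (fun w => φ ((chartAt ℂ z).symm w)) (chartAt ℂ z z) ∧
      deriv (fun w => φ ((chartAt ℂ z).symm w)) (chartAt ℂ z z) ≠ 0)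
    {x : Fin N → C} (hx : ∀ i, x i ∈ V) :
    ∃ u, HolAt u x ∧ u x ≠ 0 ∧ ∀ᶠ y in 𝓝 x, diffProd φ y = diagEq x y * u y := by
  classical
  choose! u hu using fun p (_ : p ∈ Finset.univ.filter fun p : Fin N × Fin N => p.1 < p.2) =>
    exists_sub_eq_ite_mul hinj hφ hx p.1 p.2
  refine ⟨fun y => ∏ p : Fin N × Fin N with p.1 < p.2, u p y,
    HolAt.prod _ fun p hp => (hu p hp).1, Finset.prod_ne_zero_iff.2 fun p hp => (hu p hp).2.1, ?_⟩
  filter_upwards [(Filter.eventually_all_finset _).2 fun p hp => (hu p hp).2.2] with y hy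
  rw [diagEq_eq_prod, ← Finset.prod_mul_distrib]
  exact Finset.prod_congr rfl hy

variable [IsManifold 𝓘(ℂ) ω C] [T2Space C]
  (L : C → Type*) [∀ z, AddCommGroup (L z)] [∀ z, Module ℂ (L z)]
  [∀ z, TopologicalSpace (L z)] [TopologicalSpace (TotalSpace ℂ L)]
  [FiberBundle ℂ L] [VectorBundle ℂ ℂ L] [ContMDiffVectorBundle ω ℂ L 𝓘(ℂ)]

/-- One coordinate `φ` and one frame `l` serve all factors at once; this symmetry makes the section
equivariant over all of `V ^ N`. -/
theorem nonempty_invariantFrame (b : ℕ) (p : SymPow C N) : Nonempty (InvariantFrame L b p) := by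
  obtain ⟨x₀, rfl⟩ := symQuot_surjective p
  obtain ⟨V, φ, l, hV, hxV, hinj, h⟩ := exists_coordinate_and_frame L (finite_range x₀)
  have hmem : ∀ x : Fin N → C, symQuot x ∈ symQuot '' {x : Fin N → C | ∀ i, x i ∈ V} →
      ∀ i, x i ∈ V := by
    rintro x ⟨y, hy, hxy⟩ i
    obtain ⟨σ, rfl⟩ := symQuot_eq_iff.1 hxy
    exact hy _
  refine ⟨⟨symQuot '' {x | ∀ i, x i ∈ V}, ?_, ?_,
    fun y => diffProd φ y ^ b • PiTensorProduct.tprod ℂ fun i => l (y i), ?_, ?_⟩⟩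
  · refine isOpenQuotientMap_symQuot.isOpenMap _ (isOpen_iff_mem_nhds.2 fun y hy => ?_)
    exact eventually_mem_pi fun i => hV.mem_nhds (hy i)
  · exact ⟨x₀, fun i => hxV ⟨i, rfl⟩, rfl⟩
  · intro x hx
    have hx := hmem x hx
    obtain ⟨u, hu, hu0, hd⟩ := exists_diffProd_eq hinj (fun z hz => ⟨(h z hz).1, (h z hz).2.1⟩) hx
    refine ⟨fun y => u y ^ b * ∏ i, (trivializationAt ℂ L (x i)).linearMapAt ℂ (y i) (l (y i)),
      (hu.pow b).mul (HolAt.prod _ fun i _ => ?_),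
      mul_ne_zero (pow_ne_zero b hu0) (Finset.prod_ne_zero_iff.2 fun i _ => (h _ (hx i)).2.2.2), ?_⟩
    · exact HolAt.comp_apply
        (g := fun z => (trivializationAt ℂ L (x i)).linearMapAt ℂ z (l z)) (h _ (hx i)).2.2.1
    · filter_upwards [hd] with y hy
      rw [map_smul, boxCoord, PiTensorProduct.lift.tprod, hy]
      simp only [MultilinearMap.compLinearMap_apply, MultilinearMap.mkPiAlgebra_apply, smul_eq_mul]
      ring
  -- The sign of `σ` to the power `b` coming from `diffProd φ ^ b` is the scalar in `permLift`, and
  -- reindexing permutes the factors `l (x i)`.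
  · intro σ x _
    rw [permLift, LinearMap.smul_apply, map_smul]
    simp only [LinearEquiv.coe_coe, PiTensorProduct.reindex_tprod]
    rw [diffProd_comp_perm, Equiv.Perm.sign_symm, mul_pow, mul_smul]
    rfl

end

end

/-- Let `C` be a closed Riemann surface, `L` a holomorphic line bundle on `C`, and `b ≥ 1`. There
are a holomorphic line bundle `E = 𝐋_b` on `S^N C` and a morphism of line bundles `Φ : q^* E → 𝐋`
which identifies `q^* E` with `𝐋(-b Δ)`, and through which the holomorphic sections of `E` over an
open set `U` are the `S_N`-invariant sections of `𝐋(-b Δ)` over `q⁻¹ U`. -/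
theorem mainTheorem5
    {C : Type*} [TopologicalSpace C] [T2Space C] [CompactSpace C] [ConnectedSpace C]
    [ChartedSpace ℂ C] [IsManifold 𝓘(ℂ) ω C]
    (L : C → Type*) [∀ z, AddCommGroup (L z)] [∀ z, Module ℂ (L z)]
    [∀ z, TopologicalSpace (L z)] [TopologicalSpace (TotalSpace ℂ L)]
    [FiberBundle ℂ L] [VectorBundle ℂ ℂ L] [ContMDiffVectorBundle ω ℂ L 𝓘(ℂ)]
    (N b : ℕ) (hb : 1 ≤ b) :
    ∃ (E : SymLineBundle C N)
      (Φ : ∀ x : Fin N → C, E.Fiber (symQuot x) →ₗ[ℂ] BoxFiber L x),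
      (∀ W : Set (Fin N → C), IsOpen W →
        Set.BijOn
          (fun (t : ∀ x : W, E.Fiber (symQuot x.1)) (x : W) => Φ x.1 (t x))
          (E.pullbackSections W) (twistedSections L b W)) ∧
      (∀ U : Set (SymPow C N), IsOpen U →
        Set.BijOn
          (fun (t : ∀ p : U, E.Fiber p.1)
            (x : ↥((symQuot : (Fin N → C) → SymPow C N) ⁻¹' U)) =>
              Φ x.1 (t ⟨symQuot x.1, x.2⟩))
          (E.sections U) (invariantSections L b U)) := by
  have f : ∀ p : SymPow C N, InvariantFrame L b p := fun p => (nonempty_invariantFrame L b p).some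
  exact ⟨frameBundle f, frameMap f, fun W hW => bijOn_pullbackSections f hW,
    fun U hU => bijOn_sections f hU⟩
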